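/- Let $x,y$ be vectors in the Euclidean unit sphere $S^{n-1}\subset\mathbb{R}^n$, and for $a\in\mathbb{R}^n$ let $C(a)=\{\delta\in S^{n-1} : \langle a,\delta\rangle>0\}$ denote the open hemisphere centred at $a$. Let $\alpha = 1-\frac{2}{\pi}\,\mathrm{ang}(x,y)$, where $\mathrm{ang}(x,y)=\arccos\langle x,y\rangle$, and suppose that $\alpha>0$. Let $m>2n/\alpha$ be an integer and let $a_1,\dots,a_m$ be independent random vectors, each uniformly distributed (with respect to surface measure) on the hemisphere $C(x)$. Then $$\Pr\Big[\,C(y)\subseteq \bigcup_{i=1}^m C(a_i)\Big]\;\ge\; 1-\exp\!\left(-\frac{(\alpha m-2n)^2}{2m}\right).$$ -/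

import Mathlib

open MeasureTheory ProbabilityTheory

/-- The unit sphere of `ℝⁿ` with its Euclidean norm, as a type. -/
abbrev UnitSphere (n : ℕ) : Type :=
  Metric.sphere (0 : EuclideanSpace ℝ (Fin n)) 1

/-- The open hemisphere (cap of central angle `π / 2`) centred at `a`: all unit vectors `δ`
with `⟨a, δ⟩ > 0`. -/
def hemisphere {n : ℕ} (a : EuclideanSpace ℝ (Fin n)) : Set (UnitSphere n) :=
  {δ | 0 < inner ℝ a (δ : EuclideanSpace ℝ (Fin n))}

/-- The surface measure on the unit sphere of `ℝⁿ` induced by Lebesgue measure. -/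
noncomputable def surfaceMeasure (n : ℕ) : Measure (UnitSphere n) :=
  (volume : Measure (EuclideanSpace ℝ (Fin n))).toSphere

/-! Covering fails exactly when some `δ` with `⟨y, δ⟩ = 1` satisfies `⟨a i, δ⟩ ≤ 0` for all `i`,
that is, when the polar slice is nonempty. Any such `δ` makes an angle below `π / 2` with `y`, hence
at most `π * (1 - α / 2)` with `x`. A lune occupies at most its angle over `π` of the half ball, so
each `a i` satisfies a fixed such constraint with probability at most `q = 1 - α / 2`
(`cond_hemisphere_compl_le`).

There are infinitely many `δ`, so a union bound is unavailable. Instead, a nonempty slice has a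
unique point of least norm, and by Helly's theorem in the hyperplane at most `n` constraints `B`
already force that least norm (`exists_finset_polarSliceMeets`). For every `T ⊇ B` the minimiser for
`T` then satisfies the constraints outside `T` too. That minimiser depends only on the vectors in
`T`, so by independence this event has probability at most `q ^ (m - |T|)`
(`measure_sameMinNorm_le`).

Now let `T` contain each index independently with probability `t`. It contains `B` with probability
at least `t ^ n`, and averaging over `T` gives `t ^ n * P(failure) ≤ (t + (1 - t) * q) ^ m` by the
binomial theorem. Taking `t = exp (-s)`, applying Hoeffding's lemma and optimising `s` gives the
stated exponent. -/

/-! ### Volumes of lunes in the unit ball. -/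

section Lune

variable {E : Type*} [NormedAddCommGroup E] [InnerProductSpace ℝ E]

/-- The part of the open unit ball lying on the positive side of `a` and not on the positive side
of `b`. -/
def ballLune (a b : E) : Set E :=
  {z | z ∈ Metric.ball (0 : E) 1 ∧ 0 < inner ℝ a z ∧ inner ℝ b z ≤ 0}

/-- The point at angle `t` on the unit circle spanned by the orthonormal pair `x`, `v`. -/
noncomputable def circlePoint (x v : E) (t : ℝ) : E := Real.cos t • x + Real.sin t • v

lemma inner_circlePoint {x v : E} (hx : ‖x‖ = 1) (hv : ‖v‖ = 1) (hxv : inner ℝ x v = 0)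
    (s t : ℝ) : inner ℝ (circlePoint x v s) (circlePoint x v t) = Real.cos (s - t) := by
  have hvx : inner ℝ v x = 0 := by rw [real_inner_comm]; exact hxv
  simp only [circlePoint, inner_add_left, inner_add_right, real_inner_smul_left,
    real_inner_smul_right, hxv, hvx, real_inner_self_eq_norm_sq, hx, hv, Real.cos_sub]
  ring

lemma norm_circlePoint {x v : E} (hx : ‖x‖ = 1) (hv : ‖v‖ = 1) (hxv : inner ℝ x v = 0)
    (t : ℝ) : ‖circlePoint x v t‖ = 1 := by
  have h := inner_circlePoint hx hv hxv t t
  rw [real_inner_self_eq_norm_sq, sub_self, Real.cos_zero] at h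
  nlinarith [norm_nonneg (circlePoint x v t)]

lemma reflection_circlePoint {x v : E} (hx : ‖x‖ = 1) (hv : ‖v‖ = 1) (hxv : inner ℝ x v = 0)
    (d t : ℝ) :
    (Submodule.span ℝ {circlePoint x v d}).reflection (circlePoint x v t) =
      circlePoint x v (2 * d - t) := by
  rw [Submodule.reflection_singleton_apply, inner_circlePoint hx hv hxv,
    norm_circlePoint hx hv hxv]
  have h1 : Real.cos (2 * d - t) = 2 * Real.cos (d - t) * Real.cos d - Real.cos t := by
    have h := Real.cos_sub d (d - t)
    rw [sub_sub_cancel] at h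
    rw [show 2 * d - t = d + (d - t) by ring, Real.cos_add, h]
    ring
  have h2 : Real.sin (2 * d - t) = 2 * Real.cos (d - t) * Real.sin d - Real.sin t := by
    have h := Real.sin_sub d (d - t)
    rw [sub_sub_cancel] at h
    rw [show 2 * d - t = d + (d - t) by ring, Real.sin_add, h]
    ring
  simp only [circlePoint, h1, h2, RCLike.ofReal_real_eq_id, id]
  module

/-- Rotation by the angle `r` in the plane of an orthonormal pair. -/
lemma exists_rotation {x v : E} (hx : ‖x‖ = 1) (hv : ‖v‖ = 1) (hxv : inner ℝ x v = 0) (r : ℝ) :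
    ∃ R : E ≃ₗᵢ[ℝ] E, ∀ t, R (circlePoint x v t) = circlePoint x v (r + t) := by
  refine ⟨(Submodule.span ℝ {circlePoint x v 0}).reflection.trans
    (Submodule.span ℝ {circlePoint x v (r / 2)}).reflection, fun t ↦ ?_⟩
  simp only [LinearIsometryEquiv.trans_apply, reflection_circlePoint hx hv hxv]
  congr 1
  ring

variable [FiniteDimensional ℝ E] [MeasurableSpace E] [BorelSpace E]

lemma measurableSet_ballLune (a b : E) : MeasurableSet (ballLune a b) := by
  refine measurableSet_ball.inter (MeasurableSet.inter ?_ ?_)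
  · exact measurableSet_lt measurable_const (by fun_prop : Measurable fun z : E ↦ inner ℝ a z)
  · exact measurableSet_le (by fun_prop : Measurable fun z : E ↦ inner ℝ b z) measurable_const

lemma volume_ballLune_ne_top (a b : E) : volume (ballLune a b) ≠ ⊤ :=
  ((measure_mono fun _ hz ↦ hz.1).trans_lt
    (measure_ball_lt_top (μ := volume) (x := (0 : E)) (r := 1))).ne

lemma volume_ballLune_rotate {x v : E} (hx : ‖x‖ = 1) (hv : ‖v‖ = 1) (hxv : inner ℝ x v = 0)
    (r s t : ℝ) :
    volume.real (ballLune (circlePoint x v (r + s)) (circlePoint x v (r + t))) =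
      volume.real (ballLune (circlePoint x v s) (circlePoint x v t)) := by
  obtain ⟨R, hR⟩ := exists_rotation hx hv hxv r
  have h : R ⁻¹' ballLune (circlePoint x v (r + s)) (circlePoint x v (r + t)) =
      ballLune (circlePoint x v s) (circlePoint x v t) := by
    ext z
    simp [ballLune, ← hR]
  rw [← h, measureReal_def, measureReal_def, R.measurePreserving.measure_preimage
    (measurableSet_ballLune _ _).nullMeasurableSet]

/-- The half-space at angle `s` cuts the lune into two disjoint lunes, and the second is a rotated
copy of the lune of angle `t`. -/
lemma volume_ballLune_add {x v : E} (hx : ‖x‖ = 1) (hv : ‖v‖ = 1) (hxv : inner ℝ x v = 0)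
    {s t : ℝ} (hs : 0 ≤ s) (ht : 0 < t) (hst : s + t < Real.pi) :
    volume.real (ballLune (circlePoint x v 0) (circlePoint x v (s + t))) =
      volume.real (ballLune (circlePoint x v 0) (circlePoint x v s)) +
      volume.real (ballLune (circlePoint x v 0) (circlePoint x v t)) := by
  have hrot := volume_ballLune_rotate hx hv hxv s 0 t
  rw [add_zero] at hrot
  rw [← hrot, ← measureReal_union _ (measurableSet_ballLune _ _)
    (volume_ballLune_ne_top _ _) (volume_ballLune_ne_top _ _)]
  · congr 1
    ext z
    -- Up to a positive factor, the direction at angle `s` is a nonnegative combination of those at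
    -- `0` and `s + t`; this decides the signs in both inclusions.
    have key : Real.sin (s + t) * inner ℝ (circlePoint x v s) z =
        Real.sin t * inner ℝ (circlePoint x v 0) z +
        Real.sin s * inner ℝ (circlePoint x v (s + t)) z := by
      simp only [circlePoint, inner_add_left, real_inner_smul_left, Real.cos_zero, Real.sin_zero,
        Real.cos_add, Real.sin_add]
      have h1 := Real.sin_sq_add_cos_sq s
      linear_combination (Real.sin t * inner ℝ x z) * h1
    have hst' : 0 < Real.sin (s + t) := Real.sin_pos_of_pos_of_lt_pi (by linarith) hst
    have ht' : 0 < Real.sin t := Real.sin_pos_of_pos_of_lt_pi ht (by linarith)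
    have hs' : 0 ≤ Real.sin s := Real.sin_nonneg_of_nonneg_of_le_pi hs (by linarith)
    simp only [ballLune, Set.mem_union, Set.mem_ofPred_eq]
    constructor
    · rintro ⟨hz, h0, h1⟩
      rcases le_or_gt (inner ℝ (circlePoint x v s) z) 0 with h | h
      · exact Or.inl ⟨hz, h0, h⟩
      · exact Or.inr ⟨hz, h, h1⟩
    · rintro (⟨hz, h0, h1⟩ | ⟨hz, h0, h1⟩)
      · refine ⟨hz, h0, ?_⟩
        rcases hs.eq_or_lt with rfl | hs0
        · exact absurd h0 (not_lt.2 h1)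
        have hs'' : 0 < Real.sin s := Real.sin_pos_of_pos_of_lt_pi hs0 (by linarith)
        by_contra! hc
        nlinarith [mul_pos hs'' hc, mul_pos ht' h0]
      · refine ⟨hz, ?_, h1⟩
        by_contra! hc
        nlinarith [mul_pos hst' h0]
  · rw [Set.disjoint_left]
    rintro z ⟨-, -, h1⟩ ⟨-, h2, -⟩
    exact absurd h2 (not_lt.2 h1)

lemma volume_ballLune_nsmul {x v : E} (hx : ‖x‖ = 1) (hv : ‖v‖ = 1) (hxv : inner ℝ x v = 0)
    {s : ℝ} (hs : 0 < s) (k : ℕ) (hk : k * s < Real.pi) :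
    volume.real (ballLune (circlePoint x v 0) (circlePoint x v (k * s))) =
      k * volume.real (ballLune (circlePoint x v 0) (circlePoint x v s)) := by
  induction k with
  | zero =>
    have : ballLune (circlePoint x v 0) (circlePoint x v 0) = ∅ := by
      ext z
      simp only [ballLune, Set.mem_ofPred_eq, Set.mem_empty_iff_false, iff_false]
      rintro ⟨-, h1, h2⟩
      exact absurd h1 (not_lt.2 h2)
    simp [this]
  | succ k ih =>
    push_cast at hk ⊢
    rw [add_mul, one_mul] at hk ⊢
    rw [volume_ballLune_add hx hv hxv (by positivity) hs hk, ih (by linarith)]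
    ring

/-- The half ball on the positive side of `a`. -/
def halfBall (a : E) : Set E := {z | z ∈ Metric.ball (0 : E) 1 ∧ 0 < inner ℝ a z}

lemma volume_ballLune_le_halfBall (a b : E) :
    volume.real (ballLune a b) ≤ volume.real (halfBall a) :=
  measureReal_mono (fun _ hz ↦ ⟨hz.1, hz.2.1⟩) ((measure_mono fun _ hz ↦ hz.1).trans_lt
    (measure_ball_lt_top (μ := volume) (x := (0 : E)) (r := 1))).ne

/-- Additivity forces linear growth. With steps of angle `θ / N`, the number of steps below `π`
misses `π / (θ / N)` by at most one, and that one step costs an error of order `1 / N`. -/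
lemma volume_ballLune_circlePoint_le {x v : E} (hx : ‖x‖ = 1) (hv : ‖v‖ = 1)
    (hxv : inner ℝ x v = 0) {θ : ℝ} (hθ : 0 < θ) (hθ' : θ < Real.pi) :
    Real.pi * volume.real (ballLune (circlePoint x v 0) (circlePoint x v θ)) ≤
      θ * volume.real (halfBall x) := by
  set g := volume.real (ballLune (circlePoint x v 0) (circlePoint x v θ)) with hg
  set G := volume.real (halfBall x) with hG
  have hx0 : circlePoint x v 0 = x := by simp [circlePoint]
  have key : ∀ N : ℕ, 0 < N → Real.pi * g ≤ θ * G + θ * g / N := by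
    intro N hN
    have hN' : (0 : ℝ) < N := Nat.cast_pos.2 hN
    have hs : 0 < θ / N := by positivity
    have hgN := volume_ballLune_nsmul hx hv hxv hs N (by rwa [mul_div_cancel₀ _ hN'.ne'])
    rw [mul_div_cancel₀ _ hN'.ne', ← hg] at hgN
    set gs := volume.real (ballLune (circlePoint x v 0) (circlePoint x v (θ / N)))
    have hgs : 0 ≤ gs := measureReal_nonneg
    have hpos : 0 < ⌈Real.pi / (θ / N)⌉₊ := Nat.ceil_pos.2 (by positivity)
    -- `M` steps stay strictly below `π`, as additivity requires, while `M + 1` steps reach it.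
    obtain ⟨M, hM⟩ : ∃ M, ⌈Real.pi / (θ / N)⌉₊ = M + 1 := ⟨_, (Nat.succ_pred_eq_of_pos hpos).symm⟩
    have h1 : (M : ℝ) < Real.pi / (θ / N) := Nat.lt_ceil.1 (by lia)
    have h2 : Real.pi / (θ / N) ≤ (M + 1 : ℕ) := hM ▸ Nat.le_ceil _
    rw [lt_div_iff₀ hs] at h1
    rw [div_le_iff₀ hs] at h2
    push_cast at h2
    have hM' := volume_ballLune_nsmul hx hv hxv hs M h1
    have hle := volume_ballLune_le_halfBall (circlePoint x v 0) (circlePoint x v (M * (θ / N)))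
    rw [hM', hx0] at hle
    have e : (M + 1) * (θ / N) * g = θ * (M * gs + gs) := by
      rw [hgN]; field_simp
    have e2 : θ * g / N = θ * gs := by rw [hgN]; field_simp
    have : M * gs ≤ G := by simpa [gs, hx0] using hle
    have hg0 : 0 ≤ g := measureReal_nonneg
    calc Real.pi * g ≤ (M + 1) * (θ / N) * g := by gcongr
      _ = θ * (M * gs + gs) := e
      _ ≤ θ * (G + gs) := by gcongr
      _ = _ := by rw [e2]; ring
  have hlim : Filter.Tendsto (fun N : ℕ ↦ θ * G + θ * g / N) Filter.atTop (nhds (θ * G + 0)) :=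
    tendsto_const_nhds.add (tendsto_const_div_atTop_nhds_zero_nat _)
  rw [add_zero] at hlim
  exact ge_of_tendsto hlim (Filter.eventually_atTop.2 ⟨1, fun N hN ↦ key N hN⟩)

/-- A lune of angle `θ` takes up at most the fraction `θ / π` of the half ball. -/
lemma volume_ballLune_le {x δ : E} (hx : ‖x‖ = 1) (hδ : δ ≠ 0)
    (hθ : InnerProductGeometry.angle x δ < Real.pi) :
    Real.pi * volume.real (ballLune x δ) ≤
      InnerProductGeometry.angle x δ * volume.real (halfBall x) := by
  set θ := InnerProductGeometry.angle x δ with hθdef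
  have hδ' : 0 < ‖δ‖ := norm_pos_iff.2 hδ
  have hcos : inner ℝ x δ = ‖δ‖ * Real.cos θ := by
    rw [← InnerProductGeometry.cos_angle_mul_norm_mul_norm x δ, hx]; ring
  rcases (InnerProductGeometry.angle_nonneg x δ).eq_or_lt with h0 | h0
  · obtain ⟨-, r, hr, rfl⟩ := InnerProductGeometry.angle_eq_zero_iff.1 h0.symm
    have : ballLune x (r • x) = ∅ := by
      ext z
      simp only [ballLune, Set.mem_ofPred_eq, Set.mem_empty_iff_false, iff_false,
        real_inner_smul_left]
      rintro ⟨-, h1, h2⟩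
      exact absurd (mul_pos hr h1) (not_lt.2 h2)
    rw [this]
    simp only [measureReal_empty, mul_zero]
    exact mul_nonneg (InnerProductGeometry.angle_nonneg _ _) measureReal_nonneg
  · have hsin : 0 < Real.sin θ := Real.sin_pos_of_pos_of_lt_pi h0 hθ
    -- Gram–Schmidt: `δ` lies at angle `θ` in the plane of `x` and `v`.
    set v : E := (‖δ‖ * Real.sin θ)⁻¹ • (δ - (‖δ‖ * Real.cos θ) • x) with hv
    have hxx : inner ℝ x x = 1 := by rw [real_inner_self_eq_norm_sq, hx]; norm_num
    have hxv : inner ℝ x v = 0 := by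
      rw [hv, real_inner_smul_right, inner_sub_right, real_inner_smul_right, hxx, hcos]
      ring
    have hδv : δ = ‖δ‖ • circlePoint x v θ := by
      have : (‖δ‖ * Real.sin θ) • v = δ - (‖δ‖ * Real.cos θ) • x := by
        rw [hv, smul_smul, mul_inv_cancel₀ (by positivity), one_smul]
      rw [circlePoint, smul_add, smul_smul, smul_smul, this]
      abel
    have hvn : ‖v‖ = 1 := by
      have h1 : ‖δ - (‖δ‖ * Real.cos θ) • x‖ ^ 2 = (‖δ‖ * Real.sin θ) ^ 2 := by
        rw [norm_sub_sq_real, real_inner_smul_right, real_inner_comm, hcos, norm_smul, hx, mul_one,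
          Real.norm_eq_abs, sq_abs]
        linear_combination ‖δ‖ ^ 2 * (-Real.sin_sq_add_cos_sq θ)
      have h2 := (sq_eq_sq₀ (norm_nonneg _) (by positivity)).1 h1
      rw [hv, norm_smul, h2, Real.norm_eq_abs, abs_of_pos (by positivity),
        inv_mul_cancel₀ (by positivity)]
    have hl : ballLune x δ = ballLune (circlePoint x v 0) (circlePoint x v θ) := by
      ext z
      have h1 : inner ℝ δ z = ‖δ‖ * inner ℝ (circlePoint x v θ) z := by
        rw [← real_inner_smul_left, ← hδv]
      have hx0 : circlePoint x v 0 = x := by simp [circlePoint]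
      simp [ballLune, hx0, h1, mul_nonpos_iff_pos_imp_nonpos, hδ', hδ'.le]
    rw [hl]
    exact volume_ballLune_circlePoint_le hx hvn hxv h0 hθ

end Lune

/-! ### From ball volumes to the uniform law on a hemisphere. -/

section Sphere

open scoped Pointwise

variable {n : ℕ}

/-- `Measure.toSphere` measures a set through the cone over it, so surface measures of
scale-invariant conditions reduce to ball volumes. -/
lemma Ioo_smul_image_sphere_cone {p : EuclideanSpace ℝ (Fin n) → Prop} (h0 : ¬ p 0)
    (hp : ∀ z, ∀ r : ℝ, 0 < r → (p (r • z) ↔ p z)) :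
    Set.Ioo (0 : ℝ) 1 • (((↑) : UnitSphere n → EuclideanSpace ℝ (Fin n)) ''
      {δ | p (δ : EuclideanSpace ℝ (Fin n))}) = {z | z ∈ Metric.ball 0 1 ∧ p z} := by
  ext z
  simp only [Set.mem_smul, Set.mem_image, Set.mem_ofPred_eq, mem_ball_zero_iff]
  constructor
  · rintro ⟨r, hr, _, ⟨δ, hδ, rfl⟩, rfl⟩
    refine ⟨?_, (hp _ r hr.1).2 hδ⟩
    rw [norm_smul, norm_eq_of_mem_sphere, mul_one, Real.norm_eq_abs, abs_of_pos hr.1]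
    exact hr.2
  · rintro ⟨hz, hpz⟩
    have hz0 : z ≠ 0 := by rintro rfl; exact h0 hpz
    have hz' : 0 < ‖z‖ := norm_pos_iff.2 hz0
    refine ⟨‖z‖, ⟨hz', hz⟩, ‖z‖⁻¹ • z, ⟨⟨‖z‖⁻¹ • z, ?_⟩, (hp _ _ (by positivity)).2 hpz, rfl⟩, ?_⟩
    · simp [norm_smul, hz'.ne']
    · rw [smul_smul, mul_inv_cancel₀ hz'.ne', one_smul]

lemma measurable_inner_sphere (a : EuclideanSpace ℝ (Fin n)) :
    Measurable fun δ : UnitSphere n ↦ inner ℝ a (δ : EuclideanSpace ℝ (Fin n)) := by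
  fun_prop

lemma measurableSet_hemisphere (a : EuclideanSpace ℝ (Fin n)) :
    MeasurableSet (hemisphere a) :=
  measurableSet_lt measurable_const (measurable_inner_sphere a)

lemma surfaceMeasure_hemisphere (a : EuclideanSpace ℝ (Fin n)) :
    surfaceMeasure n (hemisphere a) = n * volume (halfBall a) := by
  rw [surfaceMeasure, Measure.toSphere_apply' _ (measurableSet_hemisphere a), hemisphere,
    Ioo_smul_image_sphere_cone (p := fun z ↦ 0 < inner ℝ a z) (by simp)
      (fun z r hr ↦ by simp [real_inner_smul_right, hr]), finrank_euclideanSpace_fin]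
  rfl

lemma surfaceMeasure_lune (a b : EuclideanSpace ℝ (Fin n)) :
    surfaceMeasure n (hemisphere a ∩ (hemisphere b)ᶜ) = n * volume (ballLune a b) := by
  rw [surfaceMeasure, Measure.toSphere_apply' _
    ((measurableSet_hemisphere a).inter (measurableSet_hemisphere b).compl)]
  have : hemisphere a ∩ (hemisphere b)ᶜ = {δ : UnitSphere n |
      0 < inner ℝ a (δ : EuclideanSpace ℝ (Fin n)) ∧
        inner ℝ b (δ : EuclideanSpace ℝ (Fin n)) ≤ 0} := by
    ext; simp [hemisphere]
  rw [this, Ioo_smul_image_sphere_cone (p := fun z ↦ 0 < inner ℝ a z ∧ inner ℝ b z ≤ 0) (by simp)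
      (fun z r hr ↦ by simp [real_inner_smul_right, hr, mul_nonpos_iff, hr.le, hr.not_ge]),
      finrank_euclideanSpace_fin]
  rfl

/-- The uniform distribution on a hemisphere gives a point of another, closed hemisphere at
angular distance at least `π * p` at most the probability `1 - p`. -/
lemma cond_hemisphere_compl_le (x : UnitSphere n) {δ : EuclideanSpace ℝ (Fin n)} (hδ : δ ≠ 0)
    {p : ℝ} (hp : 0 < p)
    (hθ : InnerProductGeometry.angle (x : EuclideanSpace ℝ (Fin n)) δ ≤ Real.pi * (1 - p)) :
    (cond (surfaceMeasure n) (hemisphere (x : EuclideanSpace ℝ (Fin n)))) (hemisphere δ)ᶜ ≤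
      ENNReal.ofReal (1 - p) := by
  have hπ := Real.pi_pos
  have hp1 : 0 ≤ 1 - p := by
    by_contra! h
    nlinarith [InnerProductGeometry.angle_nonneg (x : EuclideanSpace ℝ (Fin n)) δ]
  have h := volume_ballLune_le (norm_eq_of_mem_sphere x) hδ (hθ.trans_lt (by nlinarith))
  have h1 : volume.real (ballLune (x : EuclideanSpace ℝ (Fin n)) δ) ≤
      (1 - p) * volume.real (halfBall (x : EuclideanSpace ℝ (Fin n))) := by
    have := h.trans (mul_le_mul_of_nonneg_right hθ measureReal_nonneg)
    rw [mul_assoc] at this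
    exact le_of_mul_le_mul_left this hπ
  have hfin : volume (halfBall (x : EuclideanSpace ℝ (Fin n))) ≠ ⊤ :=
    ((measure_mono fun _ hz ↦ hz.1).trans_lt (measure_ball_lt_top (μ := volume)
      (x := (0 : EuclideanSpace ℝ (Fin n))) (r := 1))).ne
  have h2 : volume (ballLune (x : EuclideanSpace ℝ (Fin n)) δ) ≤
      ENNReal.ofReal (1 - p) * volume (halfBall (x : EuclideanSpace ℝ (Fin n))) := by
    rw [← ENNReal.ofReal_toReal (volume_ballLune_ne_top _ _), ← ENNReal.ofReal_toReal hfin,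
      ← ENNReal.ofReal_mul hp1]
    exact ENNReal.ofReal_le_ofReal h1
  rw [cond_apply (measurableSet_hemisphere _), surfaceMeasure_lune, surfaceMeasure_hemisphere]
  calc _ ≤ ((n : ENNReal) * volume (halfBall (x : EuclideanSpace ℝ (Fin n))))⁻¹ *
        (ENNReal.ofReal (1 - p) * (n * volume (halfBall (x : EuclideanSpace ℝ (Fin n))))) := by
        rw [mul_left_comm (ENNReal.ofReal (1 - p))]
        gcongr
    _ = ENNReal.ofReal (1 - p) * (((n : ENNReal) *
        volume (halfBall (x : EuclideanSpace ℝ (Fin n))))⁻¹ *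
        (n * volume (halfBall (x : EuclideanSpace ℝ (Fin n))))) := by ring
    _ ≤ ENNReal.ofReal (1 - p) * 1 := by gcongr; exact ENNReal.inv_mul_le_one _
    _ = _ := mul_one _

lemma angle_lt_pi_div_two_of_inner_pos {E : Type*} [NormedAddCommGroup E]
    [InnerProductSpace ℝ E] {y δ : E} (h : 0 < inner ℝ y δ) :
    InnerProductGeometry.angle y δ < Real.pi / 2 := by
  rw [InnerProductGeometry.angle, Real.arccos_lt_pi_div_two]
  have hy : y ≠ 0 := by rintro rfl; simp at h
  have hδ : δ ≠ 0 := by rintro rfl; simp at h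
  have := norm_pos_iff.2 hy
  have := norm_pos_iff.2 hδ
  positivity

end Sphere

/-! ### Least-norm points of polar slices. -/

section PolarSlice

variable {E : Type*} [NormedAddCommGroup E] [InnerProductSpace ℝ E]

/-- The points of the affine hyperplane `⟨y, δ⟩ = 1` in none of the open half-spaces
`⟨b i, δ⟩ > 0`. -/
def polarSlice {ι : Type*} (y : E) (b : ι → E) : Set E :=
  {δ | inner ℝ y δ = 1 ∧ ∀ i, inner ℝ (b i) δ ≤ 0}

lemma isClosed_polarSlice {ι : Type*} (y : E) (b : ι → E) : IsClosed (polarSlice y b) := by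
  have h : polarSlice y b = {δ | inner ℝ y δ = 1} ∩ ⋂ i, {δ | inner ℝ (b i) δ ≤ 0} := by
    ext; simp [polarSlice]
  rw [h]
  exact (isClosed_eq (by fun_prop) continuous_const).inter
    (isClosed_iInter fun i ↦ isClosed_le (by fun_prop) continuous_const)

lemma convex_polarSlice {ι : Type*} (y : E) (b : ι → E) : Convex ℝ (polarSlice y b) := by
  intro u hu v hv s t hs ht hst
  refine ⟨?_, fun i ↦ ?_⟩
  · rw [inner_add_right, real_inner_smul_right, real_inner_smul_right, hu.1, hv.1]
    linarith
  · rw [inner_add_right, real_inner_smul_right, real_inner_smul_right]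
    nlinarith [mul_nonpos_of_nonneg_of_nonpos hs (hu.2 i),
      mul_nonpos_of_nonneg_of_nonpos ht (hv.2 i)]

lemma IsClosed.exists_forall_norm_le [FiniteDimensional ℝ E] {s : Set E} (hs : IsClosed s)
    (hne : s.Nonempty) : ∃ u ∈ s, ∀ v ∈ s, ‖u‖ ≤ ‖v‖ := by
  have := FiniteDimensional.proper_real E
  obtain ⟨u, hu, h⟩ := hs.exists_infDist_eq_dist hne 0
  refine ⟨u, hu, fun v hv ↦ ?_⟩
  have := Metric.infDist_le_dist_of_mem (x := (0 : E)) hv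
  rw [h] at this
  simpa using this

/-- By strict convexity of the norm, the midpoint of two distinct minimisers would be shorter. -/
lemma Convex.eq_of_forall_norm_le {s : Set E} (hs : Convex ℝ s) {u v : E} (hu : u ∈ s)
    (hv : v ∈ s) (hmin : ∀ w ∈ s, ‖u‖ ≤ ‖w‖) (huv : ‖v‖ ≤ ‖u‖) : u = v := by
  by_contra hne
  have h := (norm_midpoint_lt_iff (le_antisymm (hmin v hv) huv)).2 hne
  refine absurd (hmin ((1 / 2 : ℝ) • (u + v)) ?_) (not_le.2 h)
  rw [smul_add]
  exact hs hu hv (by norm_num) (by norm_num) (by norm_num)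

/-- There is a point of norm at most `r` in the polar slice. -/
def PolarSliceMeets {ι : Type*} (y : E) (b : ι → E) (r : ℝ) : Prop :=
  ∃ δ ∈ polarSlice y b, ‖δ‖ ≤ r

/-- At most `finrank ℝ E` of the constraints determine the minimal norm of a point of a
polar slice. -/
lemma exists_finset_polarSliceMeets [FiniteDimensional ℝ E] {ι : Type*} [Fintype ι] [Nonempty ι]
    {y : E} (hy1 : ‖y‖ = 1) {b : ι → E} (hne : (polarSlice y b).Nonempty) :
    ∃ B : Finset ι, B.card ≤ Module.finrank ℝ E ∧ ∀ T : Finset ι, B ⊆ T → ∀ r,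
      PolarSliceMeets y (fun i : T ↦ b i) r → PolarSliceMeets y b r := by
  obtain ⟨u, hu, hmin⟩ := (isClosed_polarSlice y b).exists_forall_norm_le hne
  let K : Submodule ℝ E := (Submodule.span ℝ {y})ᗮ
  have hy : y ≠ 0 := norm_ne_zero_iff.1 (by rw [hy1]; exact one_ne_zero)
  have hyK : ∀ v : K, inner ℝ y (v : E) = 0 := fun v ↦
    Submodule.mem_orthogonal_singleton_iff_inner_right.1 v.2
  have hyy : inner ℝ y y = 1 := by rw [real_inner_self_eq_norm_sq, hy1]; norm_num
  -- Each set carries the bound of beating `‖u‖`, so minimality of `u` makes the full intersection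
  -- empty. Since `K` has dimension one less than `E`, Helly needs only `finrank ℝ E` sets.
  let F : ι → Set K := fun i ↦ {v | ‖y + (v : E)‖ < ‖u‖ ∧ inner ℝ (b i) (y + (v : E)) ≤ 0}
  have hF : ∀ i ∈ Finset.univ, Convex ℝ (F i) := by
    intro i _ v hv w hw s t hs ht hst
    have e : y + ((s • v + t • w : K) : E) = s • (y + (v : E)) + t • (y + (w : E)) := by
      have : y = (s + t) • y := by rw [hst, one_smul]
      push_cast
      nth_rw 1 [this]
      module
    constructor
    · rw [e]
      have := (convex_ball (0 : E) ‖u‖) (mem_ball_zero_iff.2 hv.1) (mem_ball_zero_iff.2 hw.1)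
        hs ht hst
      exact mem_ball_zero_iff.1 this
    · rw [e, inner_add_right, real_inner_smul_right, real_inner_smul_right]
      nlinarith [mul_nonpos_of_nonneg_of_nonpos hs hv.2, mul_nonpos_of_nonneg_of_nonpos ht hw.2]
  have hrank : Module.finrank ℝ K + 1 = Module.finrank ℝ E := by
    rw [← Submodule.finrank_add_finrank_orthogonal (Submodule.span ℝ {y}),
      finrank_span_singleton hy, add_comm]
  have hempty : ¬ (⋂ i ∈ Finset.univ, F i).Nonempty := by
    rintro ⟨v, hv⟩
    simp only [Finset.mem_univ, Set.iInter_true, Set.mem_iInter] at hv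
    refine absurd (hmin (y + v) ⟨?_, fun i ↦ (hv i).2⟩) (not_le.2 (hv (Classical.arbitrary ι)).1)
    rw [inner_add_right, hyK, hyy, add_zero]
  have hB : ∃ B : Finset ι, B.card ≤ Module.finrank ℝ E ∧ ¬ (⋂ i ∈ B, F i).Nonempty := by
    by_contra! h
    exact hempty (Convex.helly_theorem' hF fun I _ hI ↦ h I (hrank ▸ hI))
  obtain ⟨B, hBcard, hB⟩ := hB
  refine ⟨B, hBcard, fun T hT r ⟨δ, hδ, hδr⟩ ↦ ?_⟩
  by_cases hr : ‖u‖ ≤ r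
  · exact ⟨u, hu, hr⟩
  -- A point shorter than `u` satisfying the constraints in `T` would lie in every `F i` with `i ∈
  -- B`.
  · refine absurd ⟨⟨δ - y, ?_⟩, ?_⟩ hB
    · rw [Submodule.mem_orthogonal_singleton_iff_inner_right, inner_sub_right, hδ.1, hyy, sub_self]
    · simp only [Set.mem_iInter]
      intro i hi
      refine ⟨?_, ?_⟩
      · simpa using hδr.trans_lt (not_le.1 hr)
      · simpa using hδ.2 ⟨i, hT hi⟩

/-- The polar slice of `b` is nonempty, and imposing the constraints `c` as well does not increase
the minimal norm of its points. -/
def SameMinNorm {ι κ : Type*} (y : E) (b : ι → E) (c : κ → E) : Prop :=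
  (∃ k : ℕ, PolarSliceMeets y b k) ∧
    ∀ q : ℚ, PolarSliceMeets y b q → PolarSliceMeets y (Sum.elim b c) q

lemma polarSlice_sumElim {ι κ : Type*} (y : E) (b : ι → E) (c : κ → E) :
    polarSlice y (Sum.elim b c) = polarSlice y b ∩ {δ | ∀ k, inner ℝ (c k) δ ≤ 0} := by
  ext δ
  simp [polarSlice, and_assoc]

lemma exists_polarSliceMeets_nat {ι : Type*} {y : E} {b : ι → E} :
    (∃ k : ℕ, PolarSliceMeets y b k) ↔ (polarSlice y b).Nonempty := by
  constructor
  · rintro ⟨k, δ, hδ, -⟩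
    exact ⟨δ, hδ⟩
  · rintro ⟨δ, hδ⟩
    obtain ⟨k, hk⟩ := exists_nat_ge ‖δ‖
    exact ⟨k, δ, hδ, hk⟩

/-- There is a point, depending only on `y` and `b`, which satisfies the constraints `c` whenever
these do not increase the minimal norm. -/
lemma exists_forall_sameMinNorm [FiniteDimensional ℝ E] {ι κ : Type*} {y : E} (hy1 : ‖y‖ = 1)
    (b : ι → E) :
    ∃ δ : E, inner ℝ y δ = 1 ∧ ∀ c : κ → E, SameMinNorm y b c → ∀ k, inner ℝ (c k) δ ≤ 0 := by
  by_cases hne : (polarSlice y b).Nonempty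
  · obtain ⟨u, hu, hmin⟩ := (isClosed_polarSlice y b).exists_forall_norm_le hne
    refine ⟨u, hu.1, fun c hc k ↦ ?_⟩
    obtain ⟨q₀, hq₀⟩ := exists_rat_gt ‖u‖
    obtain ⟨δ₀, hδ₀, -⟩ := hc.2 q₀ ⟨u, hu, hq₀.le⟩
    obtain ⟨w, hw, hwmin⟩ :=
      (isClosed_polarSlice y (Sum.elim b c)).exists_forall_norm_le ⟨δ₀, hδ₀⟩
    have hwu : ‖w‖ ≤ ‖u‖ := by
      by_contra! h
      obtain ⟨q, hq, hq'⟩ := exists_rat_btwn h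
      obtain ⟨δ, hδ, hδq⟩ := hc.2 q ⟨u, hu, hq.le⟩
      linarith [hwmin δ hδ]
    rw [polarSlice_sumElim] at hw
    rw [(convex_polarSlice y b).eq_of_forall_norm_le hu hw.1 hmin hwu]
    exact hw.2 k
  -- For an empty slice `SameMinNorm` is false, and `y` is only a default value.
  · refine ⟨y, by rw [real_inner_self_eq_norm_sq, hy1]; norm_num, fun c hc ↦ ?_⟩
    exact absurd (exists_polarSliceMeets_nat.1 hc.1) hne

/-- The set is the projection of a closed set along a compact ball of candidates `δ`. -/
lemma isClosed_polarSliceMeets [FiniteDimensional ℝ E] {ι : Type*} (y : E) (r : ℝ) :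
    IsClosed {b : ι → E | PolarSliceMeets y b r} := by
  have := FiniteDimensional.proper_real E
  have : CompactSpace (Metric.closedBall (0 : E) r) :=
    isCompact_iff_compactSpace.1 (isCompact_closedBall 0 r)
  let C : Set (Metric.closedBall (0 : E) r × (ι → E)) :=
    {q | inner ℝ y (q.1 : E) = 1 ∧ ∀ i, inner ℝ (q.2 i) (q.1 : E) ≤ 0}
  have hC : IsClosed C := by
    have h : C = {q | inner ℝ y (q.1 : E) = 1} ∩ ⋂ i, {q | inner ℝ (q.2 i) (q.1 : E) ≤ 0} := by
      ext; simp [C]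
    rw [h]
    exact (isClosed_eq (by fun_prop) continuous_const).inter
      (isClosed_iInter fun i ↦ isClosed_le (by fun_prop) continuous_const)
  convert isClosedMap_snd_of_compactSpace _ hC using 1
  ext b
  simp only [PolarSliceMeets, polarSlice, C, Set.mem_ofPred_eq, Set.mem_image, Prod.exists,
    Subtype.exists, mem_closedBall_zero_iff]
  constructor
  · rintro ⟨δ, hδ, hr⟩
    exact ⟨δ, hr, b, hδ, rfl⟩
  · rintro ⟨δ, hr, b', hδ, rfl⟩
    exact ⟨δ, hδ, hr⟩

end PolarSlice

/-! ### Hoeffding's lemma for a Bernoulli variable. -/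

lemma one_sub_add_mul_exp_neg_le {p : ℝ} (hp0 : 0 ≤ p) (hp1 : p ≤ 1) (s : ℝ) :
    1 - p + p * Real.exp (-s) ≤ Real.exp (-s * p + s ^ 2 / 8) := by
  let μ : Measure ℝ := ENNReal.ofReal (1 - p) • Measure.dirac 0 + ENNReal.ofReal p • Measure.dirac 1
  have : IsProbabilityMeasure μ := by
    constructor
    simp only [μ, Measure.add_apply, Measure.smul_apply, measure_univ, smul_eq_mul, mul_one]
    rw [← ENNReal.ofReal_add (by linarith) hp0]
    simp
  have hint : ∀ f : ℝ → ℝ, ∫ x, f x ∂μ = (1 - p) * f 0 + p * f 1 := by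
    intro f
    rw [integral_add_measure, integral_smul_measure, integral_smul_measure, integral_dirac,
      integral_dirac, ENNReal.toReal_ofReal (by linarith), ENNReal.toReal_ofReal hp0]
    · simp
    · exact (integrable_dirac (by simp)).smul_measure (by simp)
    · exact (integrable_dirac (by simp)).smul_measure (by simp)
  have hb : ∀ᵐ x ∂μ, id x ∈ Set.Icc (0 : ℝ) 1 := by
    simp only [μ, ae_add_measure_iff]
    exact ⟨Measure.ae_smul_measure (by simp [ae_dirac_eq]) _,
      Measure.ae_smul_measure (by simp [ae_dirac_eq]) _⟩
  have h := (hasSubgaussianMGF_of_mem_Icc (X := id) (μ := μ) aemeasurable_id hb).mgf_le (-s)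
  rw [mgf, hint, hint] at h
  simp only [id, mul_zero, mul_one, zero_add, zero_sub] at h
  have e1 : Real.exp (-s * -p) = Real.exp (s * p) := by ring_nf
  have e2 : Real.exp (-s * (1 - p)) = Real.exp (s * p) * Real.exp (-s) := by
    rw [← Real.exp_add]; ring_nf
  have e3 : Real.exp (-s * p) * Real.exp (s * p) = 1 := by
    rw [← Real.exp_add]; simp
  rw [e1, e2] at h
  have h' := mul_le_mul_of_nonneg_left h (Real.exp_pos (-s * p)).le
  calc 1 - p + p * Real.exp (-s) = Real.exp (-s * p) * ((1 - p) * Real.exp (s * p) +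
        p * (Real.exp (s * p) * Real.exp (-s))) := by
        linear_combination (-(1 - p) - p * Real.exp (-s)) * e3
    _ ≤ _ := h'
    _ = _ := by
        rw [← Real.exp_add]
        congr 1
        simp
        ring

/-! ### Measurability, random subfamilies and the Chernoff bound. -/

section Covering

variable {n : ℕ}

lemma measurableSet_polarSliceMeets {ι : Type*} [Countable ι] (y : EuclideanSpace ℝ (Fin n))
    (r : ℝ) : MeasurableSet {b : ι → UnitSphere n |
      PolarSliceMeets y (fun i ↦ (b i : EuclideanSpace ℝ (Fin n))) r} := by
  have hc : Continuous fun (b : ι → UnitSphere n) i ↦ (b i : EuclideanSpace ℝ (Fin n)) := by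
    fun_prop
  exact ((isClosed_polarSliceMeets y r).preimage hc).measurableSet

lemma measurableSet_polarSlice_nonempty {ι : Type*} [Countable ι]
    (y : EuclideanSpace ℝ (Fin n)) : MeasurableSet {b : ι → UnitSphere n |
      (polarSlice y (fun i ↦ (b i : EuclideanSpace ℝ (Fin n)))).Nonempty} := by
  simp only [← exists_polarSliceMeets_nat, Set.ofPred_exists]
  exact MeasurableSet.iUnion fun k ↦ measurableSet_polarSliceMeets y k

/-- Quantifying radii over `ℕ` and `ℚ` in `SameMinNorm` leaves a countable combination of closed
conditions. -/
lemma measurableSet_sameMinNorm {ι κ : Type*} [Countable ι] [Countable κ]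
    (y : EuclideanSpace ℝ (Fin n)) :
    MeasurableSet {q : (ι → UnitSphere n) × (κ → UnitSphere n) |
      SameMinNorm y (fun i ↦ (q.1 i : EuclideanSpace ℝ (Fin n)))
        (fun k ↦ (q.2 k : EuclideanSpace ℝ (Fin n)))} := by
  have hs : ∀ r : ℝ, MeasurableSet {q : (ι → UnitSphere n) × (κ → UnitSphere n) |
      PolarSliceMeets y (Sum.elim (fun i ↦ (q.1 i : EuclideanSpace ℝ (Fin n)))
        (fun k ↦ (q.2 k : EuclideanSpace ℝ (Fin n)))) r} := by
    intro r
    have hc : Continuous fun (q : (ι → UnitSphere n) × (κ → UnitSphere n)) ↦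
        (Sum.elim (fun i ↦ (q.1 i : EuclideanSpace ℝ (Fin n)))
        (fun k ↦ (q.2 k : EuclideanSpace ℝ (Fin n)))) := by
      refine continuous_pi fun j ↦ ?_
      rcases j with i | k
      · simp only [Sum.elim_inl]; fun_prop
      · simp only [Sum.elim_inr]; fun_prop
    exact ((isClosed_polarSliceMeets y r).preimage hc).measurableSet
  have hf : ∀ r : ℝ, MeasurableSet {q : (ι → UnitSphere n) × (κ → UnitSphere n) |
      PolarSliceMeets y (fun i ↦ (q.1 i : EuclideanSpace ℝ (Fin n))) r} := fun r ↦
    measurable_fst (measurableSet_polarSliceMeets y r)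
  simp only [SameMinNorm, measurableSet_setOfPred] at hs hf ⊢
  exact (Measurable.exists fun k : ℕ ↦ hf k).and
    (Measurable.forall fun q : ℚ ↦ (hf q).imp (hs q))

variable {m : ℕ} {Ω : Type*} [MeasurableSpace Ω] {P : Measure Ω} [IsProbabilityMeasure P]
  {a : Fin m → Ω → UnitSphere n}

lemma measurableSet_sameMinNorm_subfamily (ha_meas : ∀ i, Measurable (a i))
    (y : EuclideanSpace ℝ (Fin n)) (T : Finset (Fin m)) :
    MeasurableSet {ω | SameMinNorm y (fun i : T ↦ (a i ω : EuclideanSpace ℝ (Fin n)))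
      (fun i : (Tᶜ : Finset (Fin m)) ↦ (a i ω : EuclideanSpace ℝ (Fin n)))} := by
  have hm : Measurable fun ω ↦ ((fun (i : T) ↦ a i ω), fun (i : (Tᶜ : Finset (Fin m))) ↦ a i ω) :=
    (measurable_pi_lambda _ fun i : T ↦ ha_meas i).prodMk
      (measurable_pi_lambda _ fun i : (Tᶜ : Finset (Fin m)) ↦ ha_meas i)
  exact hm (measurableSet_sameMinNorm y)

/-- Once the vectors in `T` are fixed, one point `δ` must satisfy all the remaining constraints,
which are independent of `T`; Fubini integrates the fibrewise bound. -/
lemma measure_sameMinNorm_le (ha_meas : ∀ i, Measurable (a i)) (ha_indep : iIndepFun a P)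
    {y : EuclideanSpace ℝ (Fin n)} (hy : ‖y‖ = 1) {q : ENNReal}
    (hq : ∀ δ, inner ℝ y δ = 1 → ∀ i, P (a i ⁻¹' (hemisphere δ)ᶜ) ≤ q) (T : Finset (Fin m)) :
    P {ω | SameMinNorm y (fun i : T ↦ (a i ω : EuclideanSpace ℝ (Fin n)))
      (fun i : (Tᶜ : Finset (Fin m)) ↦ (a i ω : EuclideanSpace ℝ (Fin n)))} ≤
      q ^ (m - T.card) := by
  let X : Ω → (T → UnitSphere n) := fun ω i ↦ a i ω
  let Y : Ω → ((Tᶜ : Finset (Fin m)) → UnitSphere n) := fun ω i ↦ a i ω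
  have hX : Measurable X := measurable_pi_lambda _ fun i ↦ ha_meas i
  have hY : Measurable Y := measurable_pi_lambda _ fun i ↦ ha_meas i
  have hXY : IndepFun X Y P :=
    ha_indep.indepFun_finset T Tᶜ disjoint_compl_right ha_meas
  have hmap := (indepFun_iff_map_prod_eq_prod_map_map hX.aemeasurable hY.aemeasurable).1 hXY
  have := Measure.isProbabilityMeasure_map hX.aemeasurable (μ := P)
  have := Measure.isProbabilityMeasure_map hY.aemeasurable (μ := P)
  let W : Set ((T → UnitSphere n) × ((Tᶜ : Finset (Fin m)) → UnitSphere n)) :=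
    {q | SameMinNorm y (fun i ↦ (q.1 i : EuclideanSpace ℝ (Fin n)))
        (fun k ↦ (q.2 k : EuclideanSpace ℝ (Fin n)))}
  have hW : MeasurableSet W := measurableSet_sameMinNorm y
  change P ((fun ω ↦ (X ω, Y ω)) ⁻¹' W) ≤ _
  rw [← Measure.map_apply (hX.prodMk hY) hW, hmap, Measure.prod_apply hW]
  have hfib : ∀ u, (P.map Y) (Prod.mk u ⁻¹' W) ≤ q ^ (m - T.card) := by
    intro u
    obtain ⟨δ, hδ, hδ'⟩ := exists_forall_sameMinNorm (κ := (Tᶜ : Finset (Fin m))) hy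
      (fun i ↦ (u i : EuclideanSpace ℝ (Fin n)))
    rw [Measure.map_apply hY (measurable_prodMk_left hW)]
    calc P (Y ⁻¹' (Prod.mk u ⁻¹' W)) ≤ P (⋂ i ∈ Tᶜ, a i ⁻¹' (hemisphere δ)ᶜ) := by
          refine measure_mono fun ω hω ↦ ?_
          simp only [Set.mem_iInter]
          intro i hi
          have := hδ' _ hω ⟨i, hi⟩
          simp only [Set.mem_preimage, Set.mem_compl_iff, hemisphere, Set.mem_ofPred_eq, not_lt]
          rw [real_inner_comm]
          exact this
      _ = ∏ i ∈ Tᶜ, P (a i ⁻¹' (hemisphere δ)ᶜ) :=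
          ha_indep.measure_inter_preimage_eq_mul Tᶜ
            fun i _ ↦ (measurableSet_hemisphere δ).compl
      _ ≤ ∏ i ∈ Tᶜ, q := Finset.prod_le_prod' fun i _ ↦ hq δ hδ i
      _ = q ^ (m - T.card) := by rw [Finset.prod_const, Finset.card_compl, Fintype.card_fin]
  calc _ ≤ ∫⁻ _, q ^ (m - T.card) ∂(P.map X) := lintegral_mono hfib
    _ = _ := by simp

/-- For `t` in `[0, 1]`, both sides are the probability that a random subset, taking each index
independently with probability `t`, contains `B`. Algebraically, a product with factors `t` on `B`
and `t + (1 - t)` elsewhere is expanded. -/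
lemma pow_card_eq_sum_superset {ι R : Type*} [Fintype ι] [DecidableEq ι] [CommRing R]
    (B : Finset ι) (t : R) :
    t ^ B.card = ∑ T : Finset ι, if B ⊆ T then t ^ T.card * (1 - t) ^ (Fintype.card ι - T.card)
      else 0 := by
  have h := Finset.prod_add (fun _ : ι ↦ t) (fun i ↦ if i ∈ B then 0 else 1 - t) Finset.univ
  have h1 : ∏ i : ι, (t + if i ∈ B then 0 else 1 - t) = t ^ B.card := by
    rw [← Finset.prod_const, ← Finset.prod_subset (Finset.subset_univ B)]
    · exact Finset.prod_congr rfl fun i hi ↦ by simp [hi]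
    · intro i _ hi
      simp [hi]
  rw [← h1, h, Finset.powerset_univ]
  refine Finset.sum_congr rfl fun T _ ↦ ?_
  rw [Finset.prod_const]
  split_ifs with hT
  · congr 1
    rw [← Finset.card_compl, ← Finset.prod_const, ← Finset.compl_eq_univ_sdiff]
    refine Finset.prod_congr rfl fun i hi ↦ if_neg fun hB ↦ Finset.mem_compl.1 hi (hT hB)
  · obtain ⟨i, hiB, hiT⟩ := Finset.not_subset.1 hT
    rw [Finset.prod_eq_zero (i := i) (by simp [hiT]) (by simp [hiB]), mul_zero]

/-- Chernoff-type bound for the probability that the polar slice is nonempty. -/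
lemma pow_mul_measure_polarSlice_nonempty_le (hm : 0 < m) (ha_meas : ∀ i, Measurable (a i))
    (ha_indep : iIndepFun a P) {y : EuclideanSpace ℝ (Fin n)} (hy : ‖y‖ = 1) {q : ℝ} (hq0 : 0 ≤ q)
    (hq : ∀ δ, inner ℝ y δ = 1 → ∀ i, P (a i ⁻¹' (hemisphere δ)ᶜ) ≤ ENNReal.ofReal q)
    {t : ℝ} (ht0 : 0 ≤ t) (ht1 : t ≤ 1) :
    t ^ n * P.real {ω | (polarSlice y (fun i ↦ (a i ω : EuclideanSpace ℝ (Fin n)))).Nonempty} ≤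
      (t + (1 - t) * q) ^ m := by
  have : Nonempty (Fin m) := ⟨⟨0, hm⟩⟩
  set S : Set Ω := {ω | (polarSlice y (fun i ↦ (a i ω : EuclideanSpace ℝ (Fin n)))).Nonempty}
  have hS : MeasurableSet S :=
    (measurable_pi_lambda _ ha_meas) (measurableSet_polarSlice_nonempty y)
  let W : Finset (Fin m) → Set Ω := fun T ↦
    {ω | SameMinNorm y (fun i : T ↦ (a i ω : EuclideanSpace ℝ (Fin n)))
      (fun i : (Tᶜ : Finset (Fin m)) ↦ (a i ω : EuclideanSpace ℝ (Fin n)))}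
  have hW : ∀ T, MeasurableSet (W T) := measurableSet_sameMinNorm_subfamily ha_meas y
  have hWle : ∀ T, P.real (W T) ≤ q ^ (m - T.card) := by
    intro T
    have h := measure_sameMinNorm_le ha_meas ha_indep hy hq T
    rw [← ENNReal.ofReal_pow hq0] at h
    exact ENNReal.toReal_le_of_le_ofReal (by positivity) h
  have ht1' : 0 ≤ 1 - t := by linarith
  let w : Finset (Fin m) → ℝ := fun T ↦ t ^ T.card * (1 - t) ^ (m - T.card)
  have hw : ∀ T, 0 ≤ w T := fun T ↦ by positivity
  -- The set `B` depends on `ω`, but the weight of its supersets is always at least `t ^ n`.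
  have hpt : ∀ ω, t ^ n * S.indicator 1 ω ≤ ∑ T, w T * (W T).indicator 1 ω := by
    intro ω
    by_cases hω : ω ∈ S
    · obtain ⟨B, hB, hBT⟩ := exists_finset_polarSliceMeets hy hω
      rw [finrank_euclideanSpace_fin] at hB
      have hsup : ∀ T, B ⊆ T → ω ∈ W T := by
        intro T hT
        refine ⟨exists_polarSliceMeets_nat.2 ?_, fun r hr ↦ ?_⟩
        · obtain ⟨δ, hδ⟩ := hω
          exact ⟨δ, hδ.1, fun i ↦ hδ.2 i⟩
        · obtain ⟨δ, hδ, hδr⟩ := hBT T hT r hr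
          exact ⟨δ, ⟨hδ.1, by rintro (i | i) <;> exact hδ.2 i⟩, hδr⟩
      rw [Set.indicator_of_mem hω, Pi.one_apply, mul_one]
      calc t ^ n ≤ t ^ B.card := pow_le_pow_of_le_one ht0 ht1 hB
        _ = ∑ T, if B ⊆ T then w T else 0 := by
            rw [pow_card_eq_sum_superset B t]; simp [w]
        _ ≤ _ := by
            refine Finset.sum_le_sum fun T _ ↦ ?_
            split_ifs with hT
            · rw [Set.indicator_of_mem (hsup T hT), Pi.one_apply, mul_one]
            · exact mul_nonneg (hw T) (Set.indicator_nonneg (by simp) _)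
    · rw [Set.indicator_of_notMem hω, mul_zero]
      exact Finset.sum_nonneg fun T _ ↦ mul_nonneg (hw T) (Set.indicator_nonneg (by simp) _)
  have hi : ∀ A : Set Ω, MeasurableSet A → Integrable (A.indicator (1 : Ω → ℝ)) P := fun A hA ↦
    (integrable_const (1 : ℝ)).indicator hA
  calc t ^ n * P.real S = ∫ ω, t ^ n * S.indicator 1 ω ∂P := by
        rw [integral_const_mul, integral_indicator_one hS]
    _ ≤ ∫ ω, ∑ T, w T * (W T).indicator 1 ω ∂P :=
        integral_mono ((hi S hS).const_mul _)
          (integrable_finsetSum _ fun T _ ↦ (hi _ (hW T)).const_mul _) hpt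
    _ = ∑ T, w T * P.real (W T) := by
        rw [integral_finsetSum _ fun T _ ↦ (hi _ (hW T)).const_mul _]
        refine Finset.sum_congr rfl fun T _ ↦ ?_
        rw [integral_const_mul, integral_indicator_one (hW T)]
    _ ≤ ∑ T : Finset (Fin m), t ^ T.card * ((1 - t) * q) ^ (m - T.card) := by
        refine Finset.sum_le_sum fun T _ ↦ ?_
        rw [mul_pow, ← mul_assoc]
        exact mul_le_mul_of_nonneg_left (hWle T) (hw T)
    _ = _ := Fin.sum_pow_mul_eq_add_pow _ _

/-- Uncovered points of the hemisphere correspond by rescaling to points of the slice. -/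
lemma hemisphere_subset_iUnion_iff {ι : Type*} (y : EuclideanSpace ℝ (Fin n))
    (b : ι → UnitSphere n) :
    hemisphere y ⊆ ⋃ i, hemisphere (b i : EuclideanSpace ℝ (Fin n)) ↔
      ¬ (polarSlice y (fun i ↦ (b i : EuclideanSpace ℝ (Fin n)))).Nonempty := by
  constructor
  · rintro h ⟨δ, hδ, hb⟩
    have hδ0 : δ ≠ 0 := by rintro rfl; simp at hδ
    have hδ' : 0 < ‖δ‖⁻¹ := inv_pos.2 (norm_pos_iff.2 hδ0)
    have hmem : (⟨‖δ‖⁻¹ • δ, by simp [norm_smul, hδ0]⟩ : UnitSphere n) ∈ hemisphere y := by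
      simp only [hemisphere, Set.mem_ofPred_eq, real_inner_smul_right, hδ, mul_one, hδ']
    obtain ⟨i, hi⟩ := Set.mem_iUnion.1 (h hmem)
    simp only [hemisphere, Set.mem_ofPred_eq, real_inner_smul_right] at hi
    exact absurd hi (not_lt.2 (mul_nonpos_of_nonneg_of_nonpos hδ'.le (hb i)))
  · intro h δ hδ
    by_contra hc
    simp only [Set.mem_iUnion, not_exists, hemisphere, Set.mem_ofPred_eq, not_lt] at hc hδ
    refine h ⟨(inner ℝ y (δ : EuclideanSpace ℝ (Fin n)))⁻¹ • (δ : EuclideanSpace ℝ (Fin n)), ?_, ?_⟩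
    · rw [real_inner_smul_right, inv_mul_cancel₀ hδ.ne']
    · intro i
      rw [real_inner_smul_right]
      exact mul_nonpos_of_nonneg_of_nonpos (inv_pos.2 hδ).le (hc i)

end Covering

theorem lemma3 {n m : ℕ} (x y : UnitSphere n) (α : ℝ)
    (hα : α = 1 - 2 / Real.pi *
      InnerProductGeometry.angle (x : EuclideanSpace ℝ (Fin n)) (y : EuclideanSpace ℝ (Fin n)))
    (hα_pos : 0 < α)
    (hm : 2 * (n : ℝ) / α < (m : ℝ))
    {Ω : Type*} [MeasurableSpace Ω] (P : Measure Ω) [IsProbabilityMeasure P]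
    (a : Fin m → Ω → UnitSphere n)
    (ha_meas : ∀ i, Measurable (a i))
    (ha_indep : iIndepFun a P)
    (ha_unif : ∀ i, pdf.IsUniform (a i)
      (hemisphere (x : EuclideanSpace ℝ (Fin n))) P (surfaceMeasure n)) :
    MeasurableSet {ω | hemisphere (y : EuclideanSpace ℝ (Fin n)) ⊆
      ⋃ i, hemisphere (a i ω : EuclideanSpace ℝ (Fin n))} ∧
    1 - Real.exp (-((α * m - 2 * n) ^ 2 / (2 * m))) ≤
      P.real {ω | hemisphere (y : EuclideanSpace ℝ (Fin n)) ⊆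
        ⋃ i, hemisphere (a i ω : EuclideanSpace ℝ (Fin n))} := by
  have hπ := Real.pi_pos
  have hm0 : (0 : ℝ) < m := lt_of_le_of_lt (by positivity) hm
  rw [div_lt_iff₀ hα_pos] at hm
  have hy : ‖(y : EuclideanSpace ℝ (Fin n))‖ = 1 := norm_eq_of_mem_sphere y
  have hα1 : α ≤ 1 := by
    have := InnerProductGeometry.angle_nonneg (x : EuclideanSpace ℝ (Fin n))
      (y : EuclideanSpace ℝ (Fin n))
    have : 0 ≤ 2 / Real.pi * InnerProductGeometry.angle (x : EuclideanSpace ℝ (Fin n))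
      (y : EuclideanSpace ℝ (Fin n)) := by positivity
    linarith
  have hangle : InnerProductGeometry.angle (x : EuclideanSpace ℝ (Fin n))
      (y : EuclideanSpace ℝ (Fin n)) = Real.pi * (1 - α) / 2 := by
    rw [hα]; field_simp; ring
  have hq : ∀ δ, inner ℝ (y : EuclideanSpace ℝ (Fin n)) δ = 1 → ∀ i,
      P (a i ⁻¹' (hemisphere δ)ᶜ) ≤ ENNReal.ofReal (1 - α / 2) := by
    intro δ hδ i
    rw [← Measure.map_apply (ha_meas i) (measurableSet_hemisphere δ).compl, ha_unif i]
    refine cond_hemisphere_compl_le x (by rintro rfl; simp at hδ) (by linarith) ?_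
    have h1 := InnerProductGeometry.angle_le_angle_add_angle (x : EuclideanSpace ℝ (Fin n))
      (y : EuclideanSpace ℝ (Fin n)) δ
    have h2 := angle_lt_pi_div_two_of_inner_pos (hδ ▸ one_pos)
    rw [hangle] at h1
    linarith
  set S : Set Ω := {ω | (polarSlice (y : EuclideanSpace ℝ (Fin n))
    (fun i ↦ (a i ω : EuclideanSpace ℝ (Fin n)))).Nonempty} with hSdef
  have hS : MeasurableSet S :=
    (measurable_pi_lambda _ ha_meas) (measurableSet_polarSlice_nonempty _)
  simp only [hemisphere_subset_iUnion_iff]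
  change MeasurableSet Sᶜ ∧ _ ≤ P.real Sᶜ
  refine ⟨hS.compl, ?_⟩
  rw [probReal_compl_eq_one_sub hS]
  suffices h : P.real S ≤ Real.exp (-((α * m - 2 * n) ^ 2 / (2 * m))) by linarith
  -- This minimises the exponent `n * s - m * (α / 2) * s + m * s ^ 2 / 8`; the hypothesis on `m`
  -- makes it nonnegative, so that `exp (-s) ≤ 1`.
  set s : ℝ := 4 * (m * (α / 2) - n) / m with hs
  have hs0 : 0 ≤ s := by
    have : 0 ≤ m * (α / 2) - n := by linarith
    positivity
  have hch := pow_mul_measure_polarSlice_nonempty_le (Nat.cast_pos.1 hm0) ha_meas ha_indep hy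
    (by linarith) hq (Real.exp_pos (-s)).le (Real.exp_le_one_iff.2 (by linarith))
  have hho := one_sub_add_mul_exp_neg_le (p := α / 2) (by linarith) (by linarith) s
  have hb : Real.exp (-s) + (1 - Real.exp (-s)) * (1 - α / 2) =
      1 - α / 2 + α / 2 * Real.exp (-s) := by ring
  rw [hb] at hch
  have h0 : 0 ≤ 1 - α / 2 + α / 2 * Real.exp (-s) := by
    have := Real.exp_pos (-s)
    nlinarith
  have hfin := hch.trans (pow_le_pow_left₀ h0 hho m)
  rw [← Real.exp_nat_mul, ← Real.exp_nat_mul] at hfin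
  have h2 := mul_le_mul_of_nonneg_left hfin (Real.exp_pos (n * s)).le
  rw [← mul_assoc, ← Real.exp_add, ← Real.exp_add] at h2
  have e0 : n * s + n * -s = 0 := by ring
  rw [e0, Real.exp_zero, one_mul] at h2
  refine h2.trans_eq ?_
  congr 1
  rw [hs]
  field_simp
  ring
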